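/- Let $H$ be a complex Hilbert space and let $B(H)$ be the algebra of bounded linear operators on $H$. Let $\mathcal N$ be a complete nest on $H$: a totally ordered set of orthogonal projections in $B(H)$ that contains $0$ and $I$ and is a complete sublattice of the lattice of projections of $B(H)$. Let $\mathcal T(\mathcal N)$ be its nest algebra, that is, the algebra of all $T\in B(H)$ with $T(P(H))\subseteq P(H)$ for all $P\in\mathcal N$. Write $P^\perp=I-P$. For $x,y\in H$ let $x\otimes y$ be the operator $z\mapsto\langle z,x\rangle y$, with the inner product linear in its first variable. For $z\in H$ put $$P_z=\bigwedge\{Q\in\mathcal N: Qz=z\},\qquad \hat P_z=\bigvee\{Q\in\mathcal N: Qz=0\}.$$ For $\mathcal X\subseteq B(H)$ let $\overline{\operatorname{span}}^{\,w}(\mathcal X)$ be the closure of the linear span of $\mathcal X$ in the weak operator topology; weakly closed means closed in this topology. A linear subspace $\mathcal M\subseteq B(H)$ is a $\mathcal T(\mathcal N)$-bimodule if $\mathcal M\,\mathcal T(\mathcal N)\subseteq\mathcal M$ and $\mathcal T(\mathcal N)\,\mathcal M\subseteq\mathcal M$. A left order continuous homomorphism on $\mathcal N$ is an order-preserving map $\phi:\mathcal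 N\to\mathcal N$ with $\phi(\bigvee\mathcal X)=\bigvee\phi(\mathcal X)$ for every subset $\mathcal X\subseteq\mathcal N$. Let $\mathcal M$ be a linear subspace of $B(H)$ and put $$\mathcal J(\mathcal M)=\overline{\operatorname{span}}^{\,w}\{x\otimes y: x,y\in H,\ P_yB(H)\hat P_x^\perp\subseteq\mathcal M\}.$$ The following assertions are equivalent. (i) $\mathcal M$ is a weakly closed $\mathcal T(\mathcal N)$-bimodule. (ii) $\mathcal M=\mathcal J(\mathcal M)$. (iii) The map $\phi$ defined on $\mathcal N$ by $$\phi(P)=\bigvee\{Q\in\mathcal N:\ \text{there is } R\in\mathcal N \text{ with } R<P \text{ and } QB(H)R^\perp\subseteq\mathcal M\}$$ is a left order continuous homomorphism on $\mathcal N$, and $$\mathcal M=\{T\in B(H):\ \phi(P)^\perp TP=0\ \text{for all } P\in\mathcal N\}.$$ (iv) $$\mathcal M=\overline{\operatorname{span}}^{\,w}\Bigl(\bigcup\{QB(H)P^\perp:\ P,Q\in\mathcal N,\ QB(H)P^\perp\subseteq\mathcal M\}\Bigr).$$ -/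

import Mathlib

open scoped InnerProductSpace

namespace NestAlgebra

variable {H : Type*} [NormedAddCommGroup H] [InnerProductSpace ℂ H] [CompleteSpace H]

/-- The join of a family of orthogonal projections in the lattice of projections of `B(H)`:
the projection onto the closed linear span of the ranges. -/
noncomputable def projSup (X : Set (H →L[ℂ] H)) : H →L[ℂ] H :=
  (⨆ P ∈ X, P.range).topologicalClosure.starProjection

/-- The meet of a family of orthogonal projections in the lattice of projections of `B(H)`:
the projection onto the intersection of the ranges (the ranges of projections are closed, so that
taking the closure of the intersection changes nothing). -/
noncomputable def projInf (X : Set (H →L[ℂ] H)) : H →L[ℂ] H :=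
  (⨅ P ∈ X, P.range).topologicalClosure.starProjection

/-- A complete nest: a totally ordered family of orthogonal projections containing `0` and `I`
which is a complete sublattice of the lattice of projections of `B(H)`.
(The order on operators is the Loewner order.) -/
structure IsCompleteNest (N : Set (H →L[ℂ] H)) : Prop where
  isStarProjection : ∀ P ∈ N, IsStarProjection P
  total : ∀ P ∈ N, ∀ Q ∈ N, P ≤ Q ∨ Q ≤ P
  zero_mem : (0 : H →L[ℂ] H) ∈ N
  one_mem : (1 : H →L[ℂ] H) ∈ N
  sup_mem : ∀ X ⊆ N, projSup X ∈ N
  inf_mem : ∀ X ⊆ N, projInf X ∈ N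

/-- The nest algebra `T(N)`: all operators leaving invariant the range of every projection
in `N`. -/
def nestAlgebra (N : Set (H →L[ℂ] H)) : Set (H →L[ℂ] H) :=
  {T | ∀ P ∈ N, ∀ v ∈ P.range, T v ∈ P.range}

/-- `M` is a `T(N)`-bimodule. -/
def IsBimodule (N : Set (H →L[ℂ] H)) (M : Submodule ℂ (H →L[ℂ] H)) : Prop :=
  ∀ A ∈ M, ∀ T ∈ nestAlgebra N, A * T ∈ M ∧ T * A ∈ M

/-- A set of operators viewed in `B(H)` with the weak operator topology is closed. -/
def IsWeaklyClosed (S : Set (H →L[ℂ] H)) : Prop :=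
  IsClosed {T : H →WOT[ℂ] H | T.toCLM ∈ S}

/-- The closure in the weak operator topology of the linear span of a set of operators. -/
def weakClosedSpan (S : Set (H →L[ℂ] H)) : Set (H →L[ℂ] H) :=
  {T | ContinuousLinearMapWOT.ofCLM T ∈
    closure {A : H →WOT[ℂ] H | A.toCLM ∈ Submodule.span ℂ S}}

/-- The rank one operator `x ⊗ y : z ↦ ⟨z, x⟩ y`, where `⟨z, x⟩` is linear in `z`
(in Mathlib's convention this scalar is `⟪x, z⟫_ℂ`). -/
noncomputable def tensor (x y : H) : H →L[ℂ] H := InnerProductSpace.rankOne ℂ y x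

/-- The block `Q B(H) P^⊥`. -/
def block (Q P : H →L[ℂ] H) : Set (H →L[ℂ] H) :=
  {S | ∃ T : H →L[ℂ] H, S = Q * T * (1 - P)}

/-- `P_z`, the meet of all `Q` in `N` with `Q z = z`. -/
noncomputable def supportProj (N : Set (H →L[ℂ] H)) (z : H) : H →L[ℂ] H :=
  projInf {Q | Q ∈ N ∧ Q z = z}

/-- `P̂_z`, the join of all `Q` in `N` with `Q z = 0`. -/
noncomputable def annihilatorProj (N : Set (H →L[ℂ] H)) (z : H) : H →L[ℂ] H :=
  projSup {Q | Q ∈ N ∧ Q z = 0}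

/-- `C(M)`, the set of all `x ⊗ y` such that `P_y B(H) P̂_x^⊥ ⊆ M`. -/
def rankOneCore (N : Set (H →L[ℂ] H)) (M : Submodule ℂ (H →L[ℂ] H)) : Set (H →L[ℂ] H) :=
  {A | ∃ x y : H, A = tensor x y ∧ block (supportProj N y) (annihilatorProj N x) ⊆ M}

/-- `J(M)`, the weakly closed linear span of `C(M)`. -/
def J (N : Set (H →L[ℂ] H)) (M : Submodule ℂ (H →L[ℂ] H)) : Set (H →L[ℂ] H) :=
  weakClosedSpan (rankOneCore N M)

/-- A left order continuous homomorphism on the nest `N`: an order preserving map `N → N` with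
`φ (⋁ X) = ⋁ φ(X)` for every subset `X` of `N`. -/
structure IsLeftOrderContinuousHom (N : Set (H →L[ℂ] H)) (φ : N → N) : Prop where
  monotone : Monotone φ
  map_sup : ∀ X : Set N, ∀ S : N, (S : H →L[ℂ] H) = projSup (Subtype.val '' X) →
    (φ S : H →L[ℂ] H) = projSup (Subtype.val '' (φ '' X))

/-- The set of all `Q` in `N` such that `Q B(H) R^⊥ ⊆ M` for some `R` in `N` with `R < P`. -/
def phiSet (N : Set (H →L[ℂ] H)) (M : Submodule ℂ (H →L[ℂ] H)) (P : H →L[ℂ] H) :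
    Set (H →L[ℂ] H) :=
  {Q | Q ∈ N ∧ ∃ R ∈ N, R < P ∧ block Q R ⊆ M}

end NestAlgebra

/-!
Throughout, `φ(P) = ⋁ phiSet N M P`. Left order continuity of `φ` holds for every subspace `M`. The
weakly closed span of the blocks contained in `M` is a weakly closed bimodule, and so is
`{T | ∀ P, φ(P)^⊥ T P = 0}`. Moreover `J N M` is the former, since a block lies in the weakly closed
span of its rank one operators (`IsCompleteNest.J_eq_weakClosedSpan_blockUnion`).
What remains is to prove, for a weakly closed bimodule `M`, the cycle of inclusions

`M ⊆ {T | ∀ P, φ(P)^⊥ T P = 0} ⊆ weakClosedSpan (blocks contained in M) ⊆ M`.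

* First inclusion (`IsCompleteNest.subset_phiOperators`). If `T ∈ M` and `c ⊗ d`, `a ⊗ b` lie in the
  nest algebra, then `(a ⊗ b) T (c ⊗ d) = ⟪a, T d⟫ • (c ⊗ b)` lies in `M`. So if `T d` is outside the
  range of `φ(P)` for some `d` in the range of `P`, letting `b` and `c` vary shows that `M` contains a
  block which the definition of `φ(P)` excludes.

* Second inclusion (`IsCompleteNest.phiOperators_subset`). The identity is a weak limit of linear
  combinations of rank one operators of the nest algebra
  (`IsCompleteNest.one_mem_weakClosedSpan_tensor`), so it suffices to treat `T (c ⊗ d) = c ⊗ T d`,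
  which is again annihilated by all maps `φ(P)^⊥ · P`. Such a rank one operator is a limit of rank
  one operators taken from blocks in `M` (`IsCompleteNest.tensor_mem_of_forall`).

The approximation of the identity is proved by duality. A weakly continuous functional is the trace
pairing with a finite rank operator `F`, and it annihilates the rank one operators of the nest
algebra exactly when `F` maps the range of each `P` into the join of the ranges of the strictly
smaller members of the nest. Since `F` has finite rank, it then maps the range of each `P ≠ 0` into
the range of a single strictly smaller member (`IsCompleteNest.exists_lt_forall_mem_range`).
Therefore `F` has no nonzero eigenvalue, its trace vanishes, and the functional annihilates the
identity (`IsCompleteNest.sum_inner_eq_zero`).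
-/

namespace NestAlgebra

variable {H : Type*} [NormedAddCommGroup H] [InnerProductSpace ℂ H]

/-! ### The order of a complete nest through ranges of projections -/

section Nest

variable [CompleteSpace H] {N : Set (H →L[ℂ] H)} {P Q : H →L[ℂ] H} {X : Set (H →L[ℂ] H)}

lemma mem_range_iff_of_isStarProjection (hP : IsStarProjection P) {v : H} :
    v ∈ P.range ↔ P v = v :=
  LinearMap.IsIdempotentElem.mem_range_iff
    (ContinuousLinearMap.isIdempotentElem_toLinearMap_iff.mpr hP.isIdempotentElem)

lemma isClosed_range_of_isStarProjection (hP : IsStarProjection P) :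
    IsClosed (P.range : Set H) := by
  have h : (P.range : Set H) = {v | P v = v} :=
    Set.ext fun _ => mem_range_iff_of_isStarProjection hP
  rw [h]
  exact isClosed_eq P.continuous continuous_id

lemma mem_orthogonal_range_iff (hP : IsStarProjection P) {v : H} :
    v ∈ P.rangeᗮ ↔ P v = 0 := by
  rw [ContinuousLinearMap.orthogonal_range, hP.isSelfAdjoint.adjoint_eq]
  rfl

lemma one_sub_apply_mem_orthogonal (hP : IsStarProjection P) (v : H) :
    (1 - P) v ∈ P.rangeᗮ := by
  rw [mem_orthogonal_range_iff hP]
  have h : P (P v) = P v := (mem_range_iff_of_isStarProjection hP).1 ⟨v, rfl⟩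
  simp [h]

lemma le_iff_range_le (hP : IsStarProjection P) (hQ : IsStarProjection Q) :
    P ≤ Q ↔ P.range ≤ Q.range := by
  obtain ⟨_, h₁⟩ := isStarProjection_iff_eq_starProjection_range.1 hP
  obtain ⟨_, h₂⟩ := isStarProjection_iff_eq_starProjection_range.1 hQ
  conv_lhs => rw [h₁, h₂]
  exact Submodule.starProjection_le_starProjection_iff

lemma range_projSup (X : Set (H →L[ℂ] H)) :
    (projSup X).range = (⨆ P ∈ X, P.range).topologicalClosure :=
  Submodule.range_starProjection _

/-- A property of vectors that defines a closed subspace holds on the range of a join as soon as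
it holds on the ranges of the members. -/
lemma range_projSup_le {K : Submodule ℂ H} (hK : IsClosed (K : Set H))
    (h : ∀ P ∈ X, P.range ≤ K) : (projSup X).range ≤ K := by
  rw [range_projSup]
  exact Submodule.topologicalClosure_minimal _ (iSup₂_le h) hK

variable (hN : IsCompleteNest N)
include hN

lemma IsCompleteNest.range_projInf (hX : X ⊆ N) : (projInf X).range = ⨅ P ∈ X, P.range := by
  refine (Submodule.range_starProjection _).trans (IsClosed.submodule_topologicalClosure_eq ?_)
  simp only [Submodule.coe_iInf]
  exact isClosed_biInter fun P hP =>
    isClosed_range_of_isStarProjection (hN.isStarProjection P (hX hP))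

lemma IsCompleteNest.le_iff (hP : P ∈ N) (hQ : Q ∈ N) : P ≤ Q ↔ P.range ≤ Q.range :=
  le_iff_range_le (hN.isStarProjection P hP) (hN.isStarProjection Q hQ)

lemma IsCompleteNest.le_of_not_lt (hP : P ∈ N) (hQ : Q ∈ N) (h : ¬ P < Q) : Q ≤ P := by
  rcases hN.total P hP Q hQ with h' | h'
  · exact (eq_of_le_of_not_lt h' h).ge
  · exact h'

lemma IsCompleteNest.mem_range_iff (hP : P ∈ N) {v : H} : v ∈ P.range ↔ P v = v :=
  mem_range_iff_of_isStarProjection (hN.isStarProjection P hP)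

lemma IsCompleteNest.le_projSup (hX : X ⊆ N) (hP : P ∈ X) : P ≤ projSup X := by
  rw [hN.le_iff (hX hP) (hN.sup_mem X hX), range_projSup]
  exact (le_iSup₂_of_le P hP le_rfl).trans (Submodule.le_topologicalClosure (⨆ P ∈ X, P.range))

lemma IsCompleteNest.projSup_le (hX : X ⊆ N) (hQ : Q ∈ N) (h : ∀ P ∈ X, P ≤ Q) :
    projSup X ≤ Q := by
  rw [hN.le_iff (hN.sup_mem X hX) hQ]
  exact range_projSup_le (isClosed_range_of_isStarProjection (hN.isStarProjection Q hQ))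
    fun P hP => (hN.le_iff (hX hP) hQ).1 (h P hP)

lemma IsCompleteNest.projInf_le (hX : X ⊆ N) (hP : P ∈ X) : projInf X ≤ P := by
  rw [hN.le_iff (hN.inf_mem X hX) (hX hP), hN.range_projInf hX]
  exact iInf₂_le P hP

lemma IsCompleteNest.le_projInf (hX : X ⊆ N) (hQ : Q ∈ N) (h : ∀ P ∈ X, Q ≤ P) :
    Q ≤ projInf X := by
  rw [hN.le_iff hQ (hN.inf_mem X hX), hN.range_projInf hX]
  exact le_iInf₂ fun P hP => (hN.le_iff hQ (hX hP)).1 (h P hP)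

lemma IsCompleteNest.supportProj_mem (z : H) : supportProj N z ∈ N :=
  hN.inf_mem _ fun _ h => h.1

lemma IsCompleteNest.annihilatorProj_mem (z : H) : annihilatorProj N z ∈ N :=
  hN.sup_mem _ fun _ h => h.1

lemma IsCompleteNest.supportProj_apply (z : H) : supportProj N z z = z := by
  rw [← hN.mem_range_iff (hN.supportProj_mem z), supportProj,
    hN.range_projInf (fun _ h => h.1)]
  simp only [Submodule.mem_iInf]
  exact fun Q hQ => (hN.mem_range_iff hQ.1).2 hQ.2

lemma IsCompleteNest.supportProj_le {z : H} (hQ : Q ∈ N) (h : Q z = z) : supportProj N z ≤ Q :=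
  hN.projInf_le (fun _ h => h.1) ⟨hQ, h⟩

lemma IsCompleteNest.annihilatorProj_apply (z : H) : annihilatorProj N z z = 0 := by
  rw [← mem_orthogonal_range_iff (hN.isStarProjection _ (hN.annihilatorProj_mem z)),
    Submodule.mem_orthogonal']
  -- `z` is orthogonal to the range of the join iff that range lies in the closed subspace `{z}ᗮ`.
  have h : (annihilatorProj N z).range ≤ (ℂ ∙ z)ᗮ := by
    refine range_projSup_le (Submodule.isClosed_orthogonal _) fun Q hQ v hv => ?_
    rw [Submodule.mem_orthogonal_singleton_iff_inner_right]
    exact (Submodule.mem_orthogonal' _ _).1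
      ((mem_orthogonal_range_iff (hN.isStarProjection Q hQ.1)).2 hQ.2) v hv
  exact fun v hv => Submodule.mem_orthogonal_singleton_iff_inner_right.1 (h hv)

lemma IsCompleteNest.le_annihilatorProj {z : H} (hQ : Q ∈ N) (h : Q z = 0) :
    Q ≤ annihilatorProj N z :=
  hN.le_projSup (fun _ h => h.1) ⟨hQ, h⟩

lemma IsCompleteNest.apply_eq_self_of_le (hP : P ∈ N) (hQ : Q ∈ N) (h : P ≤ Q) {v : H}
    (hv : P v = v) : Q v = v :=
  (hN.mem_range_iff hQ).1 ((hN.le_iff hP hQ).1 h ((hN.mem_range_iff hP).2 hv))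

lemma IsCompleteNest.apply_eq_zero_of_le (hP : P ∈ N) (hQ : Q ∈ N) (h : P ≤ Q) {v : H}
    (hv : Q v = 0) : P v = 0 :=
  (mem_orthogonal_range_iff (hN.isStarProjection P hP)).1
    (Submodule.orthogonal_le ((hN.le_iff hP hQ).1 h)
      ((mem_orthogonal_range_iff (hN.isStarProjection Q hQ)).2 hv))

end Nest

/-! ### Weakly closed spans -/

section Weak

lemma continuous_mul_mul (A B : H →L[ℂ] H) :
    Continuous fun T : H →WOT[ℂ] H => ContinuousLinearMapWOT.ofCLM (A * T.toCLM * B) :=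
  ContinuousLinearMapWOT.continuous_of_dual_apply_continuous fun x y =>
    ContinuousLinearMapWOT.continuous_dual_apply (B x) (y.comp A)

lemma IsWeaklyClosed.mul_mul {S : Set (H →L[ℂ] H)} (hS : IsWeaklyClosed S) (A B : H →L[ℂ] H) :
    IsWeaklyClosed {T | A * T * B ∈ S} :=
  hS.preimage (continuous_mul_mul A B)

lemma isWeaklyClosed_singleton_zero : IsWeaklyClosed ({0} : Set (H →L[ℂ] H)) := by
  have h : {T : H →WOT[ℂ] H | T.toCLM ∈ ({0} : Set (H →L[ℂ] H))} = {0} := by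
    ext T
    exact ⟨fun h => ContinuousLinearMapWOT.toCLM_injective h,
      fun h => congrArg ContinuousLinearMapWOT.toCLM h⟩
  rw [IsWeaklyClosed, h]
  exact isClosed_singleton

lemma isWeaklyClosed_weakClosedSpan (S : Set (H →L[ℂ] H)) : IsWeaklyClosed (weakClosedSpan S) :=
  isClosed_closure

/-- `weakClosedSpan S` as a submodule. -/
noncomputable def weakClosedSpanSubmodule (S : Set (H →L[ℂ] H)) : Submodule ℂ (H →L[ℂ] H) :=
  (((Submodule.span ℂ S).comap
    (ContinuousLinearMapWOT.linearEquiv ℂ).toLinearMap).topologicalClosure).comap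
      (ContinuousLinearMapWOT.linearEquiv ℂ).symm.toLinearMap

lemma subset_weakClosedSpan (S : Set (H →L[ℂ] H)) : S ⊆ weakClosedSpan S :=
  fun _ hA => subset_closure (Submodule.subset_span hA)

lemma weakClosedSpan_minimal {S : Set (H →L[ℂ] H)} {K : Submodule ℂ (H →L[ℂ] H)}
    (hK : IsWeaklyClosed (K : Set (H →L[ℂ] H))) (h : S ⊆ K) : weakClosedSpan S ⊆ K :=
  fun _ hT => closure_minimal (t := {A : H →WOT[ℂ] H | A.toCLM ∈ (K : Set (H →L[ℂ] H))})
    (fun _ hA => Submodule.span_le.2 h hA) hK hT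

/-- A Hahn–Banach criterion for the weak operator topology: an operator annihilated by every
functional `A ↦ ∑ i, ⟪y i, A (x i)⟫` that annihilates `S` lies in the weakly closed span of `S`.
-/
lemma mem_weakClosedSpan_of_forall_sum_inner_eq_zero.{u} {H : Type u} [NormedAddCommGroup H]
    [InnerProductSpace ℂ H] [CompleteSpace H] {S : Set (H →L[ℂ] H)} {T : H →L[ℂ] H}
    (h : ∀ (ι : Type u) [Fintype ι] (x y : ι → H),
      (∀ A ∈ S, ∑ i, ⟪y i, A (x i)⟫_ℂ = 0) → ∑ i, ⟪y i, T (x i)⟫_ℂ = 0) :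
    T ∈ weakClosedSpan S := by
  classical
  -- Every finite set of matrix coefficients of `T` is attained exactly on the span of `S`.
  have key : ∀ s : Finset (H × H), ∃ A ∈ Submodule.span ℂ S,
      ∀ p ∈ s, ⟪p.2, A p.1⟫_ℂ = ⟪p.2, T p.1⟫_ℂ := by
    intro s
    let Φ : (H →L[ℂ] H) →ₗ[ℂ] (s → ℂ) :=
      { toFun := fun A p => ⟪p.1.2, A p.1.1⟫_ℂ
        map_add' := fun A B => by ext p; simp
        map_smul' := fun c A => by ext p; simp }
    suffices hΦ : Φ T ∈ (Submodule.span ℂ S).map Φ by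
      obtain ⟨A, hA, hAT⟩ := hΦ
      exact ⟨A, hA, fun p hp => congrFun hAT ⟨p, hp⟩⟩
    by_contra hΦ
    obtain ⟨f, hfT, hf⟩ := Submodule.exists_le_ker_of_notMem hΦ
    have hfsum : ∀ A, f (Φ A) =
        ∑ p : s, ⟪starRingEnd ℂ (f (Pi.single p 1)) • p.1.2, A p.1.1⟫_ℂ := by
      intro A
      rw [LinearMap.pi_apply_eq_sum_univ f (Φ A)]
      refine Finset.sum_congr rfl fun p _ => ?_
      rw [inner_smul_left, RingHomCompTriple.comp_apply, RingHom.id_apply, smul_eq_mul, mul_comm]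
      congr 2
      ext j
      simp [Pi.single_apply, eq_comm]
    refine hfT ?_
    rw [hfsum]
    refine h s (fun p => p.1.1) (fun p => starRingEnd ℂ (f (Pi.single p 1)) • p.1.2) ?_
    intro A hA
    rw [← hfsum]
    exact hf ⟨A, Submodule.subset_span hA, rfl⟩
  choose A hA hAT using key
  refine mem_closure_of_tendsto
    (f := fun s : Finset (H × H) => ContinuousLinearMapWOT.ofCLM (A s)) (b := Filter.atTop) ?_
    (Filter.Eventually.of_forall hA)
  rw [ContinuousLinearMapWOT.tendsto_iff_forall_inner_apply_tendsto]
  intro x y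
  refine tendsto_const_nhds.congr' ?_
  filter_upwards [Filter.eventually_ge_atTop {(x, y)}] with s hs
  exact (hAT s (x, y) (hs (Finset.mem_singleton_self _))).symm

end Weak

/-! ### Rank one operators of the nest algebra -/

section RankOne

@[simp]
lemma tensor_apply (x y z : H) : tensor x y z = ⟪x, z⟫_ℂ • y := rfl

lemma isClosed_setOf_tensor_left_mem {K : Submodule ℂ (H →L[ℂ] H)}
    (hK : IsWeaklyClosed (K : Set (H →L[ℂ] H))) (y : H) : IsClosed {x | tensor x y ∈ K} := by
  refine hK.preimage (f := fun x => ContinuousLinearMapWOT.ofCLM (tensor x y)) ?_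
  refine ContinuousLinearMapWOT.continuous_of_dual_apply_continuous fun z f => ?_
  simp only [ContinuousLinearMapWOT.ofCLM_apply, tensor_apply]
  fun_prop

lemma isClosed_setOf_tensor_right_mem {K : Submodule ℂ (H →L[ℂ] H)}
    (hK : IsWeaklyClosed (K : Set (H →L[ℂ] H))) (x : H) : IsClosed {y | tensor x y ∈ K} := by
  refine hK.preimage (f := fun y => ContinuousLinearMapWOT.ofCLM (tensor x y)) ?_
  refine ContinuousLinearMapWOT.continuous_of_dual_apply_continuous fun z f => ?_
  simp only [ContinuousLinearMapWOT.ofCLM_apply, tensor_apply]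
  fun_prop

variable [CompleteSpace H] {N : Set (H →L[ℂ] H)}

lemma mul_tensor_mul (A B : H →L[ℂ] H) (x y : H) :
    A * tensor x y * B = tensor (ContinuousLinearMap.adjoint B x) (A y) := by
  ext z
  simp [ContinuousLinearMap.adjoint_inner_left]

lemma mul_tensor_mul_one_sub {P : H →L[ℂ] H} (hP : IsStarProjection P) (A : H →L[ℂ] H) (x y : H) :
    A * tensor x y * (1 - P) = tensor (x - P x) (A y) := by
  rw [mul_tensor_mul, hP.one_sub.isSelfAdjoint.adjoint_eq]
  simp

/-- The condition under which `c ⊗ d` lies in the nest algebra: some `P` in the nest fixes `d`,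
while every strictly smaller member of the nest kills `c`. -/
def IsNestPair (N : Set (H →L[ℂ] H)) (c d : H) : Prop :=
  ∃ P ∈ N, P d = d ∧ ∀ R ∈ N, R < P → R c = 0

variable (hN : IsCompleteNest N)
include hN

lemma IsCompleteNest.tensor_mem_nestAlgebra {c d : H} (h : IsNestPair N c d) :
    tensor c d ∈ nestAlgebra N := by
  obtain ⟨P, hP, hd, hc⟩ := h
  intro R hR v hv
  by_cases hRP : R < P
  · have h0 : ⟪c, v⟫_ℂ = 0 := (Submodule.mem_orthogonal' _ _).1
      ((mem_orthogonal_range_iff (hN.isStarProjection R hR)).2 (hc R hR hRP)) v hv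
    simp [h0]
  · rw [hN.mem_range_iff hR, tensor_apply, map_smul,
      hN.apply_eq_self_of_le hP hR (hN.le_of_not_lt hR hP hRP) hd]

/-- If a finite rank operator `F` maps the range of each `P` in the nest into the join of the
ranges of the strictly smaller members, then for `P ≠ 0` it even maps the range of `P` into the
range of one strictly smaller member. If `P` has an immediate predecessor this is clear; otherwise
the intersections of the finite-dimensional range of `F` with the ranges of the members below `P`
stabilise. -/
lemma IsCompleteNest.exists_lt_forall_mem_range {F : H →L[ℂ] H} {V : Submodule ℂ H}
    [FiniteDimensional ℂ V] (hFV : ∀ v, F v ∈ V)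
    (hF : ∀ P ∈ N, ∀ v ∈ P.range, F v ∈ (projSup {R | R ∈ N ∧ R < P}).range)
    {P : H →L[ℂ] H} (hP : P ∈ N) (hP0 : P ≠ 0) :
    ∃ R ∈ N, R < P ∧ ∀ v ∈ P.range, F v ∈ R.range := by
  have hsub : ∀ P : H →L[ℂ] H, {R | R ∈ N ∧ R < P} ⊆ N := fun _ _ h => h.1
  have hle : ∀ P ∈ N, projSup {R | R ∈ N ∧ R < P} ≤ P := fun P hP =>
    hN.projSup_le (hsub P) hP fun R hR => hR.2.le
  rcases (hle P hP).lt_or_eq with hlt | heq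
  · exact ⟨_, hN.sup_mem _ (hsub P), hlt, hF P hP⟩
  have h0 : (0 : H →L[ℂ] H) < P := by
    refine lt_of_le_of_ne ?_ hP0.symm
    rw [hN.le_iff hN.zero_mem hP]
    rintro _ ⟨w, rfl⟩
    simp
  -- Choose `R₀ < P` for which the dimension of `V ⊓ R₀.range` is as large as possible.
  let D : Set ℕ := {n | ∃ R ∈ N, R < P ∧ Module.finrank ℂ ↥(V ⊓ R.range) = n}
  have hDne : D.Nonempty := ⟨_, 0, hN.zero_mem, h0, rfl⟩
  have hDbdd : BddAbove D := by
    refine ⟨Module.finrank ℂ V, ?_⟩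
    rintro _ ⟨R, -, -, rfl⟩
    exact Submodule.finrank_mono inf_le_left
  obtain ⟨R₀, hR₀, hR₀P, hdim⟩ := Nat.sSup_mem hDne hDbdd
  have hmax : ∀ R ∈ N, R < P → V ⊓ R.range ≤ R₀.range := by
    intro R hR hRP
    rcases hN.total R hR R₀ hR₀ with h | h
    · exact inf_le_right.trans ((hN.le_iff hR hR₀).1 h)
    · have hV : V ⊓ R₀.range ≤ V ⊓ R.range := inf_le_inf_left V ((hN.le_iff hR₀ hR).1 h)
      have hfin : Module.finrank ℂ ↥(V ⊓ R.range) ≤ Module.finrank ℂ ↥(V ⊓ R₀.range) :=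
        hdim.symm ▸ le_csSup hDbdd ⟨R, hR, hRP, rfl⟩
      rw [← Submodule.eq_of_le_of_finrank_le hV hfin]
      exact inf_le_right
  refine ⟨R₀, hR₀, hR₀P, ?_⟩
  have hcomap : P.range ≤ R₀.range.comap F.toLinearMap := by
    rw [← heq]
    refine range_projSup_le
      ((isClosed_range_of_isStarProjection (hN.isStarProjection R₀ hR₀)).preimage F.continuous) ?_
    intro R hR v hv
    exact hmax R hR.1 hR.2
      ⟨hFV v, (hN.le_iff (hN.sup_mem _ (hsub R)) hR.1).1 (hle R hR.1) (hF R hR.1 v hv)⟩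
  exact fun v hv => hcomap hv

/-- Finite rank operators that are strictly upper triangular with respect to the nest have trace
zero: an eigenvector for a nonzero eigenvalue would lie in a member of the nest strictly smaller
than its support. The operator is `z ↦ ∑ i, ⟪y i, z⟫ x i`, and triangularity says that it
annihilates the rank one operators of the nest algebra under the trace pairing. -/
lemma IsCompleteNest.sum_inner_eq_zero {ι : Type*} [Fintype ι] (x y : ι → H)
    (h : ∀ c d, IsNestPair N c d → ∑ i, ⟪y i, tensor c d (x i)⟫_ℂ = 0) :
    ∑ i, ⟪y i, x i⟫_ℂ = 0 := by
  classical
  let F : H →L[ℂ] H := ∑ i, tensor (y i) (x i)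
  have hFapp : ∀ v, F v = ∑ i, ⟪y i, v⟫_ℂ • x i := fun v => by simp [F]
  let V : Submodule ℂ H := Submodule.span ℂ (Set.range x)
  have : FiniteDimensional ℂ V := FiniteDimensional.span_of_finite ℂ (Set.finite_range x)
  have hFV : ∀ v, F v ∈ V := fun v => by
    rw [hFapp]
    exact Submodule.sum_mem _ fun i _ =>
      Submodule.smul_mem _ _ (Submodule.subset_span ⟨i, rfl⟩)
  have hF : ∀ P ∈ N, ∀ v ∈ P.range, F v ∈ (projSup {R | R ∈ N ∧ R < P}).range := by
    intro P hP d hd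
    rw [range_projSup, ← Submodule.orthogonal_orthogonal_eq_closure, Submodule.mem_orthogonal]
    intro c hc
    have hpair : IsNestPair N c d := by
      refine ⟨P, hP, (hN.mem_range_iff hP).1 hd, fun R hR hRP => ?_⟩
      rw [← mem_orthogonal_range_iff (hN.isStarProjection R hR)]
      exact Submodule.orthogonal_le (le_iSup₂_of_le R ⟨hR, hRP⟩ le_rfl) hc
    rw [hFapp, inner_sum, ← h c d hpair]
    exact Finset.sum_congr rfl fun i _ => by simp [inner_smul_right, mul_comm]
  -- The trace of the operator is the trace of the matrix `⟪y i, x j⟫`, whose nonzero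
  -- eigenvalues are eigenvalues of the operator.
  let G : Matrix ι ι ℂ := Matrix.of fun i j => ⟪y i, x j⟫_ℂ
  change G.trace = 0
  rw [Matrix.trace_eq_sum_roots_charpoly]
  refine Multiset.sum_eq_zero fun μ hμ => ?_
  by_contra hμ0
  have hspec : Module.End.HasEigenvalue (Matrix.toLin' G) μ := by
    rw [Module.End.hasEigenvalue_iff_isRoot_charpoly, Matrix.charpoly_toLin']
    exact Polynomial.isRoot_of_mem_roots hμ
  obtain ⟨w, hw⟩ := hspec.exists_hasEigenvector
  have hwG : ∀ i, ∑ j, ⟪y i, x j⟫_ℂ * w j = μ * w i := fun i => congrFun hw.apply_eq_smul i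
  let v : H := ∑ j, w j • x j
  have hyv : ∀ i, ⟪y i, v⟫_ℂ = μ * w i := fun i => by
    rw [← hwG i, inner_sum]
    exact Finset.sum_congr rfl fun j _ => by rw [inner_smul_right, mul_comm]
  have hFv : F v = μ • v := by
    rw [hFapp, Finset.smul_sum]
    exact Finset.sum_congr rfl fun i _ => by rw [hyv, mul_smul]
  have hv0 : v ≠ 0 := by
    intro hv
    refine hw.2 (funext fun i => ?_)
    have := hyv i
    rw [hv, inner_zero_right] at this
    exact (mul_eq_zero.1 this.symm).resolve_left hμ0
  have hP0 : supportProj N v ≠ 0 := by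
    intro h0
    have := hN.supportProj_apply v
    rw [h0] at this
    exact hv0 this.symm
  obtain ⟨R, hR, hRlt, hFR⟩ :=
    hN.exists_lt_forall_mem_range hFV hF (hN.supportProj_mem v) hP0
  have hvR : v ∈ R.range := by
    have := hFR v ((hN.mem_range_iff (hN.supportProj_mem v)).2 (hN.supportProj_apply v))
    rwa [hFv, Submodule.smul_mem_iff _ hμ0] at this
  exact hRlt.not_ge (hN.supportProj_le hR ((hN.mem_range_iff hR).1 hvR))

/-- The identity is a weak limit of linear combinations of rank one operators of the nest
algebra. -/
lemma IsCompleteNest.one_mem_weakClosedSpan_tensor :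
    (1 : H →L[ℂ] H) ∈ weakClosedSpan {A | ∃ c d, IsNestPair N c d ∧ A = tensor c d} :=
  mem_weakClosedSpan_of_forall_sum_inner_eq_zero fun _ _ x y h =>
    hN.sum_inner_eq_zero x y fun c d hcd => h _ ⟨c, d, hcd, rfl⟩

/-- To place `A * B` in a weakly closed subspace one may put the rank one operators of the nest
algebra between the factors. -/
lemma IsCompleteNest.mul_mem_of_forall_tensor {K : Submodule ℂ (H →L[ℂ] H)}
    (hK : IsWeaklyClosed (K : Set (H →L[ℂ] H))) (A B : H →L[ℂ] H)
    (h : ∀ c d, IsNestPair N c d → A * tensor c d * B ∈ K) : A * B ∈ K := by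
  have h1 := weakClosedSpan_minimal
    (K := K.comap (LinearMap.mulLeftRight ℂ (A, B))) (hK.mul_mul A B)
    (by rintro _ ⟨c, d, hcd, rfl⟩; exact h c d hcd) hN.one_mem_weakClosedSpan_tensor
  simpa using h1

end RankOne

/-! ### Blocks and their weakly closed span -/

section Blocks

/-- The union of all blocks `Q B(H) P^⊥` contained in `M`. -/
def blockUnion (N : Set (H →L[ℂ] H)) (M : Submodule ℂ (H →L[ℂ] H)) : Set (H →L[ℂ] H) :=
  {A | ∃ P ∈ N, ∃ Q ∈ N, block Q P ⊆ (M : Set (H →L[ℂ] H)) ∧ A ∈ block Q P}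

variable [CompleteSpace H] {N : Set (H →L[ℂ] H)} {M K : Submodule ℂ (H →L[ℂ] H)}
  {P Q : H →L[ℂ] H}

lemma tensor_mem_block (hP : IsStarProjection P) {x y : H} (hx : P x = 0) (hy : Q y = y) :
    tensor x y ∈ block Q P :=
  ⟨tensor x y, by rw [mul_tensor_mul_one_sub hP, hx, hy, sub_zero]⟩

variable (hN : IsCompleteNest N)
include hN

lemma IsCompleteNest.mul_eq_right (hP : P ∈ N) (hQ : Q ∈ N) (h : P ≤ Q) : Q * P = P := by
  ext v
  exact (hN.mem_range_iff hQ).1 ((hN.le_iff hP hQ).1 h ⟨v, rfl⟩)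

lemma IsCompleteNest.block_subset_block {P' Q' : H →L[ℂ] H} (hP : P ∈ N) (hP' : P' ∈ N)
    (hQ : Q ∈ N) (hQ' : Q' ∈ N) (hPP' : P ≤ P') (hQQ' : Q' ≤ Q) : block Q' P' ⊆ block Q P := by
  rintro _ ⟨T, rfl⟩
  refine ⟨Q' * T * (1 - P'), ?_⟩
  have h : (1 - P') * (1 - P) = 1 - P' := by
    rw [sub_mul, mul_sub, mul_sub, hN.mul_eq_right hP hP' hPP']
    simp
  rw [← mul_assoc, ← mul_assoc, hN.mul_eq_right hQ' hQ hQQ', mul_assoc _ (1 - P'), h]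

/-- A weakly closed subspace contains a block as soon as it contains its rank one operators. -/
lemma IsCompleteNest.block_subset_of_tensor_mem (hK : IsWeaklyClosed (K : Set (H →L[ℂ] H)))
    (hP : P ∈ N) (hQ : Q ∈ N) (h : ∀ c d, P c = 0 → Q d = d → tensor c d ∈ K) :
    block Q P ⊆ K := by
  rintro _ ⟨T, rfl⟩
  refine hN.mul_mem_of_forall_tensor hK (Q * T) (1 - P) fun c d _ => ?_
  rw [mul_tensor_mul_one_sub (hN.isStarProjection P hP)]
  refine h _ _ ?_ ((hN.mem_range_iff hQ).1 ⟨T d, rfl⟩)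
  have hPc : P (P c) = P c := (hN.mem_range_iff hP).1 ⟨c, rfl⟩
  rw [map_sub, hPc, sub_self]

lemma IsCompleteNest.J_eq_weakClosedSpan_blockUnion (M : Submodule ℂ (H →L[ℂ] H)) :
    J N M = weakClosedSpan (blockUnion N M) := by
  refine Set.Subset.antisymm ?_ ?_
  · refine weakClosedSpan_minimal (K := weakClosedSpanSubmodule (blockUnion N M))
      (isWeaklyClosed_weakClosedSpan _) ?_
    rintro _ ⟨x, y, rfl, hxy⟩
    exact subset_weakClosedSpan _ ⟨_, hN.annihilatorProj_mem x, _, hN.supportProj_mem y, hxy,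
      tensor_mem_block (hN.isStarProjection _ (hN.annihilatorProj_mem x))
        (hN.annihilatorProj_apply x) (hN.supportProj_apply y)⟩
  · refine weakClosedSpan_minimal (K := weakClosedSpanSubmodule (rankOneCore N M))
      (isWeaklyClosed_weakClosedSpan _) ?_
    rintro A ⟨P, hP, Q, hQ, hM, hA⟩
    refine hN.block_subset_of_tensor_mem (isWeaklyClosed_weakClosedSpan _) hP hQ
      (fun c d hc hd => ?_) hA
    refine subset_weakClosedSpan (rankOneCore N M) ⟨c, d, rfl, ?_⟩
    exact (hN.block_subset_block hP (hN.annihilatorProj_mem c) hQ (hN.supportProj_mem d)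
      (hN.le_annihilatorProj hP hc) (hN.supportProj_le hQ hd)).trans hM

lemma IsCompleteNest.mul_mul_eq_mul_of_mem_nestAlgebra {T : H →L[ℂ] H} (hT : T ∈ nestAlgebra N)
    (hP : P ∈ N) : P * T * P = T * P := by
  ext v
  exact (hN.mem_range_iff hP).1 (hT P hP _ ⟨v, rfl⟩)

lemma IsCompleteNest.isBimodule_weakClosedSpan_blockUnion (M : Submodule ℂ (H →L[ℂ] H)) :
    IsBimodule N (weakClosedSpanSubmodule (blockUnion N M)) := by
  intro A hA T hT
  set W := weakClosedSpanSubmodule (blockUnion N M)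
  have hW : IsWeaklyClosed (W : Set (H →L[ℂ] H)) := isWeaklyClosed_weakClosedSpan _
  have hr : A ∈ W.comap (LinearMap.mulLeftRight ℂ (1, T)) := by
    refine weakClosedSpan_minimal (hW.mul_mul 1 T) ?_ hA
    rintro _ ⟨P, hP, Q, hQ, hM, S, rfl⟩
    refine subset_weakClosedSpan _ ⟨P, hP, Q, hQ, hM, S * (1 - P) * T, ?_⟩
    have h := hN.mul_mul_eq_mul_of_mem_nestAlgebra hT hP
    have h' : (1 - P) * T * (1 - P) = (1 - P) * T := by
      rw [mul_sub, mul_one, sub_mul, sub_mul, one_mul, h, sub_self, sub_zero]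
    simp only [LinearMap.mulLeftRight_apply, one_mul]
    rw [mul_assoc, ← h']
    simp only [mul_assoc]
  have hl : A ∈ W.comap (LinearMap.mulLeftRight ℂ (T, 1)) := by
    refine weakClosedSpan_minimal (hW.mul_mul T 1) ?_ hA
    rintro _ ⟨P, hP, Q, hQ, hM, S, rfl⟩
    refine subset_weakClosedSpan _ ⟨P, hP, Q, hQ, hM, T * Q * S, ?_⟩
    simp only [LinearMap.mulLeftRight_apply, mul_one, ← mul_assoc]
    rw [hN.mul_mul_eq_mul_of_mem_nestAlgebra hT hQ]
  simp only [Submodule.mem_comap, LinearMap.mulLeftRight_apply, mul_one, one_mul] at hr hl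
  exact ⟨hr, hl⟩

end Blocks

/-! ### The order homomorphism attached to a subspace -/

section Phi

variable [CompleteSpace H] {N : Set (H →L[ℂ] H)} {M K : Submodule ℂ (H →L[ℂ] H)}
  {P Q : H →L[ℂ] H}

/-- The operators `T` with `φ(P)^⊥ T P = 0` for all `P` in the nest, where
`φ(P) = ⋁ phiSet N M P`. -/
def phiOperators (N : Set (H →L[ℂ] H)) (M : Submodule ℂ (H →L[ℂ] H)) : Set (H →L[ℂ] H) :=
  {T | ∀ P ∈ N, (1 - projSup (phiSet N M P)) * T * P = 0}

omit [CompleteSpace H] in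
lemma phiSet_subset : phiSet N M P ⊆ N := fun _ h => h.1

variable (hN : IsCompleteNest N)
include hN

lemma IsCompleteNest.projSup_phiSet_mem (M : Submodule ℂ (H →L[ℂ] H)) (P : H →L[ℂ] H) :
    projSup (phiSet N M P) ∈ N :=
  hN.sup_mem _ phiSet_subset

lemma IsCompleteNest.mem_phiOperators_iff {T : H →L[ℂ] H} :
    T ∈ phiOperators N M ↔
      ∀ P ∈ N, ∀ v ∈ P.range, T v ∈ (projSup (phiSet N M P)).range := by
  refine forall₂_congr fun P hP => ?_
  rw [ContinuousLinearMap.ext_iff]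
  refine ⟨fun h v hv => ?_, fun h v => ?_⟩
  · rw [hN.mem_range_iff (hN.projSup_phiSet_mem M P)]
    have := h v
    exact (sub_eq_zero.1 (by simpa [(hN.mem_range_iff hP).1 hv] using this)).symm
  · have := (hN.mem_range_iff (hN.projSup_phiSet_mem M P)).1 (h (P v) ⟨v, rfl⟩)
    simp [this]

/-- Left order continuity holds for every subspace `M`: a member of the nest strictly smaller than
a join is strictly smaller than one of the joined projections. -/
lemma IsCompleteNest.isLeftOrderContinuousHom (M : Submodule ℂ (H →L[ℂ] H)) (φ : N → N)
    (hφ : ∀ P : N, (φ P : H →L[ℂ] H) = projSup (phiSet N M P)) :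
    IsLeftOrderContinuousHom N φ := by
  have hmono : Monotone φ := by
    intro P Q hPQ
    change (φ P : H →L[ℂ] H) ≤ φ Q
    rw [hφ, hφ]
    refine hN.projSup_le phiSet_subset (hN.projSup_phiSet_mem M Q) fun S hS => ?_
    obtain ⟨hSN, R, hR, hRP, hM⟩ := hS
    exact hN.le_projSup phiSet_subset ⟨hSN, R, hR, hRP.trans_le hPQ, hM⟩
  refine ⟨hmono, fun X S hS => ?_⟩
  have hX : Subtype.val '' X ⊆ N := by rintro _ ⟨P, -, rfl⟩; exact P.2
  have hφX : Subtype.val '' (φ '' X) ⊆ N := by rintro _ ⟨P, -, rfl⟩; exact P.2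
  apply le_antisymm
  · rw [hφ]
    refine hN.projSup_le phiSet_subset (hN.sup_mem _ hφX) fun Q hQ => ?_
    obtain ⟨hQN, R, hR, hRS, hM⟩ := hQ
    obtain ⟨P, hPX, hRP⟩ : ∃ P ∈ X, R < P := by
      by_contra! hcon
      rw [hS] at hRS
      refine hRS.not_ge (hN.projSup_le hX hR ?_)
      rintro _ ⟨P, hPX, rfl⟩
      exact hN.le_of_not_lt hR P.2 (hcon P hPX)
    calc Q ≤ φ P := by
          rw [hφ]; exact hN.le_projSup phiSet_subset ⟨hQN, R, hR, hRP, hM⟩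
      _ ≤ _ := hN.le_projSup hφX ⟨φ P, ⟨P, hPX, rfl⟩, rfl⟩
  · refine hN.projSup_le hφX (φ S).2 ?_
    rintro _ ⟨_, ⟨P, hPX, rfl⟩, rfl⟩
    refine hmono (show (P : H →L[ℂ] H) ≤ S from ?_)
    rw [hS]
    exact hN.le_projSup hX ⟨P, hPX, rfl⟩

lemma IsCompleteNest.isBimodule_of_eq_phiOperators
    (hM : (M : Set (H →L[ℂ] H)) = phiOperators N K) : IsBimodule N M := by
  intro A hA T hT
  rw [← SetLike.mem_coe, hM, hN.mem_phiOperators_iff] at hA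
  simp only [← SetLike.mem_coe, hM, hN.mem_phiOperators_iff]
  exact ⟨fun P hP v hv => hA P hP _ (hT P hP v hv),
    fun P hP v hv => hT _ (hN.projSup_phiSet_mem K P) _ (hA P hP v hv)⟩

omit hN in
lemma isWeaklyClosed_phiOperators : IsWeaklyClosed (phiOperators N M) := by
  have h : {T : H →WOT[ℂ] H | T.toCLM ∈ phiOperators N M} =
      ⋂ P ∈ N, {T | T.toCLM ∈
        {T | (1 - projSup (phiSet N M P)) * T * P ∈ ({0} : Set (H →L[ℂ] H))}} := by
    ext T; simp [phiOperators]
  rw [IsWeaklyClosed, h]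
  exact isClosed_biInter fun P _ => isWeaklyClosed_singleton_zero.mul_mul _ _

/-- A rank one operator `x ⊗ y` with `φ(P)^⊥ (x ⊗ y) P = 0` for all `P` belongs to every weakly
closed subspace containing the blocks in `M`. The relevant `P` are those above `E = P̂_x`; if they
have no least element, then `x` is approximated by vectors that some of them annihilate. -/
lemma IsCompleteNest.tensor_mem_of_forall (hK : IsWeaklyClosed (K : Set (H →L[ℂ] H)))
    (hblock : ∀ P ∈ N, ∀ Q ∈ N, block Q P ⊆ (M : Set (H →L[ℂ] H)) → block Q P ⊆ K) {x y : H}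
    (h : ∀ P ∈ N, P x = 0 ∨ y ∈ (projSup (phiSet N M P)).range) : tensor x y ∈ K := by
  set E := annihilatorProj N x
  have hE : E ∈ N := hN.annihilatorProj_mem x
  have hEx : E x = 0 := hN.annihilatorProj_apply x
  let X : Set (H →L[ℂ] H) := {P | P ∈ N ∧ E < P}
  have hX : X ⊆ N := fun _ h => h.1
  have hy : ∀ P ∈ X, y ∈ (projSup (phiSet N M P)).range := fun P hP =>
    (h P hP.1).resolve_left fun hPx => hP.2.not_ge (hN.le_annihilatorProj hP.1 hPx)
  -- Closedness in `y` reduces matters to vectors in the range of a member of `phiSet N M P`.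
  have hright : ∀ P ∈ X, ∀ x', (∀ R ∈ N, R < P → R x' = 0) → tensor x' y ∈ K := by
    intro P hP x' hx'
    have hle : (projSup (phiSet N M P)).range ≤
        K.comap ((InnerProductSpace.rankOne ℂ).flip x').toLinearMap := by
      refine range_projSup_le (isClosed_setOf_tensor_right_mem hK x') ?_
      rintro Q ⟨hQ, R, hR, hRP, hM⟩ y' hy'
      exact hblock R hR Q hQ hM (tensor_mem_block (hN.isStarProjection R hR) (hx' R hR hRP)
        ((hN.mem_range_iff hQ).1 hy'))
    exact hle (hy P hP)
  have hE' : projInf X ∈ N := hN.inf_mem X hX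
  rcases (hN.le_projInf hX hE fun P hP => hP.2.le).lt_or_eq with hlt | heq
  · refine hright (projInf X) ⟨hE', hlt⟩ x fun R hR hRE' => ?_
    refine hN.apply_eq_zero_of_le hR hE (hN.le_of_not_lt hE hR fun hER => ?_) hEx
    exact hRE'.not_ge (hN.projInf_le hX ⟨hR, hER⟩)
  · have hx : x ∈ (⨆ P ∈ X, P.rangeᗮ).topologicalClosure := by
      have hperp : (⨆ P ∈ X, P.rangeᗮ)ᗮ = E.range := by
        rw [heq, hN.range_projInf hX]
        rw [iSup_subtype', iInf_subtype', ← Submodule.iInf_orthogonal]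
        refine iInf_congr fun P => ?_
        rw [Submodule.orthogonal_orthogonal_eq_closure]
        exact (isClosed_range_of_isStarProjection
          (hN.isStarProjection P P.2.1)).submodule_topologicalClosure_eq
      rw [← Submodule.orthogonal_orthogonal_eq_closure, hperp,
        mem_orthogonal_range_iff (hN.isStarProjection E hE)]
      exact hEx
    have hle : (⨆ P ∈ X, P.rangeᗮ).topologicalClosure ≤
        K.comap (InnerProductSpace.rankOne ℂ y).toLinearMap := by
      refine Submodule.topologicalClosure_minimal _ (iSup₂_le fun P hP x' hx' => ?_)
        (isClosed_setOf_tensor_left_mem hK y)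
      refine hright P hP x' fun R hR hRP => ?_
      exact hN.apply_eq_zero_of_le hR hP.1 hRP.le
        ((mem_orthogonal_range_iff (hN.isStarProjection P hP.1)).1 hx')
    exact hle hx

lemma IsCompleteNest.phiOperators_subset (M : Submodule ℂ (H →L[ℂ] H)) :
    phiOperators N M ⊆ weakClosedSpan (blockUnion N M) := by
  intro T hT
  rw [hN.mem_phiOperators_iff] at hT
  set W := weakClosedSpanSubmodule (blockUnion N M)
  have hW : IsWeaklyClosed (W : Set (H →L[ℂ] H)) := isWeaklyClosed_weakClosedSpan _
  suffices T * 1 ∈ W by simpa using! this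
  refine hN.mul_mem_of_forall_tensor hW T 1 fun c d hcd => ?_
  obtain ⟨P₀, hP₀, hd, hc⟩ := hcd
  have hTcd : T * tensor c d * 1 = tensor c (T d) := by ext; simp
  rw [hTcd]
  refine hN.tensor_mem_of_forall (M := M) hW
    (fun P hP Q hQ hM A hA => subset_weakClosedSpan _ ⟨P, hP, Q, hQ, hM, hA⟩) fun P hP => ?_
  by_cases hlt : P < P₀
  · exact Or.inl (hc P hP hlt)
  · exact Or.inr (hT P hP d ((hN.mem_range_iff hP).2
      (hN.apply_eq_self_of_le hP₀ hP (hN.le_of_not_lt hP hP₀ hlt) hd)))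

/-- A weakly closed bimodule containing `T` contains the blocks seen by `T`: multiplying `T` from
both sides by rank one operators of the nest algebra, one gets, unless `T d` is already in the
range of `Q₁`, all rank one operators of the block `Q₂ B(H) R^⊥`. The hypotheses `hQ` and `hRP`
hold when `Q₁` is `Q₂` or its immediate predecessor, and `R` is `P₁` or its immediate predecessor. -/
lemma IsCompleteNest.block_subset_of_apply_notMem (hM : IsWeaklyClosed (M : Set (H →L[ℂ] H)))
    (hbi : IsBimodule N M) {T : H →L[ℂ] H} (hT : T ∈ M) {P₁ R Q₁ Q₂ : H →L[ℂ] H}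
    (hP₁ : P₁ ∈ N) (hR : R ∈ N) (hQ₁ : Q₁ ∈ N) (hQ₂ : Q₂ ∈ N)
    (hRP : ∀ S ∈ N, S < P₁ → S ≤ R) (hQ : ∀ S ∈ N, S < Q₂ → S ≤ Q₁) {d : H} (hd : P₁ d = d)
    (hTd : T d ∉ Q₁.range) : block Q₂ R ⊆ M := by
  refine hN.block_subset_of_tensor_mem hM hR hQ₂ fun c b hc hb => ?_
  let a : H := (1 - Q₁) (T d)
  have ha : Q₁ a = 0 := (mem_orthogonal_range_iff (hN.isStarProjection Q₁ hQ₁)).1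
    (one_sub_apply_mem_orthogonal (hN.isStarProjection Q₁ hQ₁) _)
  have hcd : tensor c d ∈ nestAlgebra N := hN.tensor_mem_nestAlgebra
    ⟨P₁, hP₁, hd, fun S hS hSP => hN.apply_eq_zero_of_le hS hR (hRP S hS hSP) hc⟩
  have hab : tensor a b ∈ nestAlgebra N := hN.tensor_mem_nestAlgebra
    ⟨Q₂, hQ₂, hb, fun S hS hSQ => hN.apply_eq_zero_of_le hS hQ₁ (hQ S hS hSQ) ha⟩
  have hmem := (hbi _ (hbi T hT _ hcd).1 _ hab).2
  have heq : tensor a b * (T * tensor c d) = ⟪a, T d⟫_ℂ • tensor c b := by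
    ext z; simp [smul_smul, mul_comm]
  rw [heq] at hmem
  refine (Submodule.smul_mem_iff _ fun h0 => hTd ?_).1 hmem
  have hTd_eq : T d = a + Q₁ (T d) := by simp [a]
  have h1 : ⟪a, Q₁ (T d)⟫_ℂ = 0 := (Submodule.mem_orthogonal' _ _).1
    (one_sub_apply_mem_orthogonal (hN.isStarProjection Q₁ hQ₁) _) _ ⟨T d, rfl⟩
  rw [hTd_eq, inner_add_right, h1, add_zero, inner_self_eq_zero] at h0
  rw [hTd_eq, h0, zero_add]
  exact ⟨T d, rfl⟩

lemma IsCompleteNest.subset_phiOperators (hM : IsWeaklyClosed (M : Set (H →L[ℂ] H)))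
    (hbi : IsBimodule N M) : (M : Set (H →L[ℂ] H)) ⊆ phiOperators N M := by
  intro T hT
  rw [hN.mem_phiOperators_iff]
  intro P hP
  set F := projSup (phiSet N M P)
  have hF : F ∈ N := hN.projSup_phiSet_mem M P
  have hFle : ∀ R ∈ N, R < P → ∀ Q ∈ N, F < Q → ¬ block Q R ⊆ (M : Set (H →L[ℂ] H)) :=
    fun R hR hRP Q hQ hFQ h => hFQ.not_ge (hN.le_projSup phiSet_subset ⟨hQ, R, hR, hRP, h⟩)
  let X : Set (H →L[ℂ] H) := {Q | Q ∈ N ∧ F < Q}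
  have hX : X ⊆ N := fun _ h => h.1
  -- `F` either has the immediate successor `projInf X` or is the meet of `X`.
  have key : ∀ P₁ ∈ N, ∀ R ∈ N, (∀ S ∈ N, S < P₁ → S ≤ R) → R < P →
      ∀ d ∈ P₁.range, T d ∈ F.range := by
    intro P₁ hP₁ R hR hRP₁ hRP d hd
    rw [hN.mem_range_iff hP₁] at hd
    rcases (hN.le_projInf hX hF fun Q hQ => hQ.2.le).lt_or_eq with hlt | heq
    · by_contra hTd
      refine hFle R hR hRP _ (hN.inf_mem X hX) hlt
        (hN.block_subset_of_apply_notMem hM hbi hT hP₁ hR hF (hN.inf_mem X hX) hRP₁ ?_ hd hTd)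
      exact fun S hS hSX => hN.le_of_not_lt hF hS fun hFS =>
        hSX.not_ge (hN.projInf_le hX ⟨hS, hFS⟩)
    · rw [heq, hN.range_projInf hX]
      simp only [Submodule.mem_iInf]
      intro Q hQ
      by_contra hTd
      exact hFle R hR hRP Q hQ.1 hQ.2
        (hN.block_subset_of_apply_notMem hM hbi hT hP₁ hR hQ.1 hQ.1 hRP₁
          (fun S _ hSQ => hSQ.le) hd hTd)
  -- `P` either has the immediate predecessor `projSup Y` or is the join of `Y`.
  let Y : Set (H →L[ℂ] H) := {R | R ∈ N ∧ R < P}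
  have hY : Y ⊆ N := fun _ h => h.1
  rcases (hN.projSup_le hY hP fun R hR => hR.2.le).lt_or_eq with hlt | heq
  · exact key P hP _ (hN.sup_mem Y hY) (fun S hS hSP => hN.le_projSup hY ⟨hS, hSP⟩) hlt
  · have hle : P.range ≤ F.range.comap T.toLinearMap := by
      conv_lhs => rw [← heq]
      exact range_projSup_le
        ((isClosed_range_of_isStarProjection (hN.isStarProjection F hF)).preimage T.continuous)
        fun R hR v hv => key R hR.1 R hR.1 (fun S _ hSR => hSR.le) hR.2 v hv
    exact fun v hv => hle hv

end Phi

end NestAlgebra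

/-! ### Weakly closed bimodules -/

open NestAlgebra in
theorem lemma2 {H : Type*} [NormedAddCommGroup H] [InnerProductSpace ℂ H] [CompleteSpace H]
    (N : Set (H →L[ℂ] H)) (hN : IsCompleteNest N) (M : Submodule ℂ (H →L[ℂ] H)) :
    List.TFAE [
      IsWeaklyClosed (M : Set (H →L[ℂ] H)) ∧ IsBimodule N M,
      (M : Set (H →L[ℂ] H)) = J N M,
      ∃ φ : N → N,
        (∀ P : N, (φ P : H →L[ℂ] H) = projSup (phiSet N M P)) ∧
        IsLeftOrderContinuousHom N φ ∧
        (M : Set (H →L[ℂ] H)) =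
          {T | ∀ P : N, (1 - (φ P : H →L[ℂ] H)) * T * (P : H →L[ℂ] H) = 0},
      (M : Set (H →L[ℂ] H)) =
        weakClosedSpan {A | ∃ P ∈ N, ∃ Q ∈ N,
          block Q P ⊆ (M : Set (H →L[ℂ] H)) ∧ A ∈ block Q P}] := by
  have hphi : ∀ φ : N → N, (∀ P : N, (φ P : H →L[ℂ] H) = projSup (phiSet N M P)) →
      {T | ∀ P : N, (1 - (φ P : H →L[ℂ] H)) * T * (P : H →L[ℂ] H) = 0} = phiOperators N M := by
    intro φ hφ
    ext T
    simp [phiOperators, hφ]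
  have hspan : IsWeaklyClosed (M : Set (H →L[ℂ] H)) →
      weakClosedSpan (blockUnion N M) ⊆ M := fun hM => by
    refine weakClosedSpan_minimal hM ?_
    rintro A ⟨P, -, Q, -, hblock, hA⟩
    exact hblock hA
  tfae_have 1 → 3 := by
    rintro ⟨hM, hbi⟩
    let φ : N → N := fun P => ⟨projSup (phiSet N M P), hN.projSup_phiSet_mem M P⟩
    refine ⟨φ, fun _ => rfl, hN.isLeftOrderContinuousHom M φ fun _ => rfl, ?_⟩
    rw [hphi φ fun _ => rfl]
    exact (hN.subset_phiOperators hM hbi).antisymm ((hN.phiOperators_subset M).trans (hspan hM))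
  tfae_have 3 → 1 := by
    rintro ⟨φ, hφ, -, hM⟩
    rw [hphi φ hφ] at hM
    exact ⟨hM ▸ isWeaklyClosed_phiOperators, hN.isBimodule_of_eq_phiOperators hM⟩
  tfae_have 1 → 4 := by
    rintro ⟨hM, hbi⟩
    exact ((hN.subset_phiOperators hM hbi).trans (hN.phiOperators_subset M)).antisymm (hspan hM)
  tfae_have 4 → 1 := by
    intro hM
    have hMW : M = weakClosedSpanSubmodule (blockUnion N M) := SetLike.coe_injective hM
    refine ⟨hM ▸ isWeaklyClosed_weakClosedSpan _, ?_⟩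
    rw [hMW]
    exact hN.isBimodule_weakClosedSpan_blockUnion M
  tfae_have 2 ↔ 4 := by
    rw [hN.J_eq_weakClosedSpan_blockUnion]
    rfl
  tfae_finish
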